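/- Let $n\ge 1$ and let $g,W:\mathbb R^n\to(0,\infty)$ be $C^\infty$ functions such that $g(x)$, $W(x)$, $|\nabla g(x)|$ and $|\nabla W(x)|$ tend to $+\infty$ as $|x|\to\infty$, and $$\int_{\mathbb R^n} g^{-n}\,dx=\int_{\mathbb R^n} W^{-n}\,dx=1.$$ Let $W^*(x)=\sup_{y\in\mathbb R^n}\{x\cdot y-W(y)\}\in(-\infty,+\infty]$ be the Legendre transform of $W$. Then the function $W^*(\nabla g)/g^{n+1}$ is measurable with integrable negative part, so that its integral is well defined in $(-\infty,+\infty]$, and $$\int_{\mathbb R^n}\frac{W^*(\nabla g)}{g^{n+1}}\,dx\ \ge\ 0 .$$ Moreover, if $g=W$ and this function is convex, then equality holds. -/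

import Mathlib

open MeasureTheory Filter Topology
open scoped ContDiff Gradient

/-- The Legendre transform `W*(x) = sup_y (x · y - W(y))` of a real function on a Euclidean space,
as an extended real number. -/
noncomputable def legendreTransform {n : ℕ} (W : EuclideanSpace ℝ (Fin n) → ℝ)
    (x : EuclideanSpace ℝ (Fin n)) : EReal :=
  ⨆ y : EuclideanSpace ℝ (Fin n), ((inner ℝ x y - W y : ℝ) : EReal)

/-- The integral of `f` exists as an element of `(-∞, +∞]`: `f` is a.e. measurable and its negative
part has a finite integral. -/
def HasIntegralAboveBot {α : Type*} [MeasurableSpace α] (μ : Measure α) (f : α → EReal) : Prop :=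
  AEMeasurable f μ ∧ ∫⁻ x, (-f x).toENNReal ∂μ ≠ ⊤

/-- The Lebesgue integral of an extended-real-valued function: the integral of its positive part
minus the integral of its negative part. It is meaningful under `HasIntegralAboveBot μ f`. -/
noncomputable def extendedIntegral {α : Type*} [MeasurableSpace α] (μ : Measure α)
    (f : α → EReal) : EReal :=
  ((∫⁻ x, (f x).toENNReal ∂μ : ENNReal) : EReal) - ((∫⁻ x, (-f x).toENNReal ∂μ : ENNReal) : EReal)

/-! The proof is by mass transport. Suppose `T` carries the density `g⁻ⁿ` to `W⁻ⁿ` and has a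
triangular Jacobian with positive diagonal. Then that diagonal has product `(W(T)/g)ⁿ`, so the
arithmetic-geometric mean inequality gives `div T ≥ n W(T)/g`. If the flux of `T/gⁿ` vanishes at
infinity, integrating its divergence gives `∫ ∇g·T / gⁿ⁺¹ = (1/n) ∫ div T / gⁿ ≥ ∫ W(T) / gⁿ⁺¹`.
Since `W*(∇g) ≥ ∇g·T - W(T)`, the inequality follows.

Knothe's map suffices as `T`: it is explicit and continuous, and only its diagonal derivatives enter
(`exists_knothe_transport`). To control the flux, `T` maps `[-R,R]ⁿ` into a fixed `[-k,k]ⁿ`; the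
flux is then at most `k` times the integral of `g⁻ⁿ` over the faces, which is small for suitable
large `R` (`exists_setIntegral_faces_le`). The truncated target must still carry at least the mass
of the source, so `W` is first lowered by a small `δ` (`exists_cube_le_setIntegral`), at a cost of
at most `δ ∫ g⁻ⁿ⁻¹`. `exists_transport_bound` and `lintegral_neg_part_le_pos_part` assemble this.

For `g = W` convex, `W*(∇W) = ∇W·x - W`, so the integrand is `-(1/n) div (x/Wⁿ)`. The flux of `x/Wⁿ`
out of every cube is nonnegative, which gives the reverse inequality. -/

/-! ### Cubes: Fubini and integrals of partial derivatives. -/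

/-- The cube `[-R, R]ⁿ`. -/
def cube (n : ℕ) (R : ℝ) : Set (Fin n → ℝ) := Set.Icc (fun _ => -R) (fun _ => R)

theorem isCompact_cube (n : ℕ) (R : ℝ) : IsCompact (cube n R) := isCompact_Icc

theorem measurableSet_cube (n : ℕ) (R : ℝ) : MeasurableSet (cube n R) := measurableSet_Icc

theorem mem_cube {n : ℕ} {R : ℝ} {x : Fin n → ℝ} : x ∈ cube n R ↔ ∀ i, x i ∈ Set.Icc (-R) R := by
  simp only [cube, Set.mem_Icc, Pi.le_def, forall_and]

theorem insertNth_mem_cube {n : ℕ} {R : ℝ} (i : Fin (n + 1)) (t : ℝ) (y : Fin n → ℝ) :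
    i.insertNth t y ∈ cube (n + 1) R ↔ t ∈ Set.Icc (-R) R ∧ y ∈ cube n R :=
  Fin.insertNth_mem_Icc (α := fun _ => ℝ)

theorem continuous_insertNth {n : ℕ} (i : Fin (n + 1)) :
    Continuous fun p : ℝ × (Fin n → ℝ) => (i.insertNth p.1 p.2 : Fin (n + 1) → ℝ) :=
  Continuous.finInsertNth (A := fun _ => ℝ) i continuous_fst continuous_snd

/-- A continuous function is integrable on a cube. -/
theorem Continuous.integrableOn_cube {n : ℕ} {u : (Fin n → ℝ) → ℝ} (hu : Continuous u) (R : ℝ) :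
    IntegrableOn u (cube n R) :=
  hu.continuousOn.integrableOn_compact (isCompact_cube n R)

theorem setIntegral_cube_pos {n : ℕ} {R : ℝ} (hR : 0 < R) {u : (Fin n → ℝ) → ℝ}
    (hu : Continuous u) (hpos : ∀ x, 0 < u x) : 0 < ∫ x in cube n R, u x := by
  rw [setIntegral_pos_iff_support_of_nonneg_ae (ae_of_all _ fun x => (hpos x).le)
    (hu.integrableOn_cube R)]
  have : Function.support u = Set.univ := Set.eq_univ_of_forall fun x => (hpos x).ne'
  rw [this, Set.univ_inter, cube, Real.volume_Icc_pi]
  simp only [Finset.prod_const]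
  exact ENNReal.pow_pos (by simpa using hR) _

/-- Fubini's theorem on a cube, singling out one coordinate. -/
theorem setIntegral_cube_succ {n : ℕ} (i : Fin (n + 1)) {R : ℝ} (hR : 0 ≤ R)
    {u : (Fin (n + 1) → ℝ) → ℝ} (hu : Continuous u) :
    ∫ x in cube (n + 1) R, u x
      = ∫ t in (-R)..R, ∫ y in cube n R, u (i.insertNth t y) := by
  have e := (volume_preserving_piFinSuccAbove (fun _ : Fin (n + 1) => ℝ) i).symm
  have hpre : (MeasurableEquiv.piFinSuccAbove (fun _ : Fin (n + 1) => ℝ) i).symm ⁻¹'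
      cube (n + 1) R = Set.Icc (-R) R ×ˢ cube n R := by
    ext ⟨t, y⟩
    exact insertNth_mem_cube i t y
  rw [← e.setIntegral_preimage_emb (MeasurableEquiv.measurableEmbedding _), hpre,
    Measure.volume_eq_prod, setIntegral_prod, intervalIntegral.integral_of_le (by linarith),
    integral_Icc_eq_integral_Ioc]
  · rfl
  · exact (hu.comp (continuous_insertNth i)).continuousOn.integrableOn_compact
      (isCompact_Icc.prod (isCompact_cube n R))

/-- With the singled-out variable innermost, the fundamental theorem of calculus applies on each
line. -/
theorem setIntegral_cube_succ' {n : ℕ} (i : Fin (n + 1)) {R : ℝ} (hR : 0 ≤ R)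
    {u : (Fin (n + 1) → ℝ) → ℝ} (hu : Continuous u) :
    ∫ x in cube (n + 1) R, u x
      = ∫ y in cube n R, ∫ t in (-R)..R, u (i.insertNth t y) := by
  rw [setIntegral_cube_succ i hR hu, intervalIntegral.integral_of_le (by linarith)]
  simp_rw [intervalIntegral.integral_of_le (show -R ≤ R by linarith)]
  rw [integral_integral_swap]
  rw [Measure.prod_restrict]
  exact ((hu.comp (continuous_insertNth i)).continuousOn.integrableOn_compact
      (isCompact_Icc.prod (isCompact_cube n R))).mono_set
        (Set.prod_mono Set.Ioc_subset_Icc_self le_rfl)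

/-- The integral over a cube of a partial derivative is a difference of integrals over two opposite
faces. -/
theorem setIntegral_cube_partialDeriv {n : ℕ} (i : Fin (n + 1)) {R : ℝ} (hR : 0 ≤ R)
    {u u' : (Fin (n + 1) → ℝ) → ℝ} (hu : Continuous u) (hu' : Continuous u')
    (hd : ∀ x, x i ∈ Set.Ioo (-R) R →
      HasDerivAt (fun t => u (Function.update x i t)) (u' x) (x i)) :
    ∫ x in cube (n + 1) R, u' x
      = ∫ y in cube n R, (u (i.insertNth R y) - u (i.insertNth (-R) y)) := by
  rw [setIntegral_cube_succ' i hR hu']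
  congr 1
  ext y
  have hc : Continuous fun t : ℝ => (i.insertNth t y : Fin (n + 1) → ℝ) :=
    Continuous.finInsertNth (A := fun _ => ℝ) i continuous_id continuous_const
  refine intervalIntegral.integral_eq_sub_of_hasDerivAt_of_le (by linarith)
    (f := fun t => u (i.insertNth t y)) (hu.comp hc).continuousOn (fun t ht => ?_)
    ((hu'.comp hc).intervalIntegrable _ _)
  have := hd (i.insertNth t y) (by simpa using ht)
  simpa using this

/-! ### Knothe transport between cubes. -/

/-- Monotone transport between two families of positive densities on intervals, depending
continuously on a parameter. -/
theorem exists_monotone_transport {A : Type*} [TopologicalSpace A] [FirstCountableTopology A]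
    [LocallyCompactSpace A] {F H : A → ℝ → ℝ} (hF : Continuous F.uncurry)
    (hH : Continuous H.uncurry) (hFpos : ∀ a t, 0 < F a t) (hHpos : ∀ a t, 0 < H a t)
    {R k : ℝ} (hR : 0 < R) (hk : 0 < k) :
    ∃ T : A → ℝ → ℝ, Continuous T.uncurry ∧ (∀ a t, T a t ∈ Set.Icc (-k) k) ∧
      ∀ a, ∀ t ∈ Set.Ioo (-R) R, HasDerivAt (T a)
        (F a t / (∫ s in (-R)..R, F a s) * ((∫ s in (-k)..k, H a s) / H a (T a t))) t := by
  have hFc : ∀ a, Continuous (F a) := fun a => hF.comp (Continuous.prodMk_right a)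
  have hHc : ∀ a, Continuous (H a) := fun a => hH.comp (Continuous.prodMk_right a)
  have hFi : ∀ a s t, IntervalIntegrable (F a) volume s t :=
    fun a s t => (hFc a).intervalIntegrable s t
  have hHi : ∀ a s t, IntervalIntegrable (H a) volume s t :=
    fun a s t => (hHc a).intervalIntegrable s t
  have hmF : ∀ a, 0 < ∫ s in (-R)..R, F a s := fun a =>
    intervalIntegral.intervalIntegral_pos_of_pos (hFi a _ _) (hFpos a) (by linarith)
  have hmH : ∀ a, 0 < ∫ s in (-k)..k, H a s := fun a =>
    intervalIntegral.intervalIntegral_pos_of_pos (hHi a _ _) (hHpos a) (by linarith)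
  -- Clamping `t` to `[-R, R]` keeps `Φ` between `0` and the mass of `H`, so `T` is defined and
  -- continuous on the whole line with values in `[-k, k]`.
  set c : ℝ → ℝ := fun t => max (-R) (min R t) with hc
  have hcc : Continuous c := by fun_prop
  have hcI : ∀ t, c t ∈ Set.Icc (-R) R := fun t =>
    ⟨le_max_left _ _, max_le (by linarith) (min_le_left _ _)⟩
  set Φ : A → ℝ → ℝ := fun a t =>
    (∫ s in (-R)..c t, F a s) / (∫ s in (-R)..R, F a s) * ∫ s in (-k)..k, H a s with hΦ
  set Ψ : A → ℝ → ℝ := fun a y => ∫ s in (-k)..y, H a s with hΨ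
  have hΨc : Continuous Ψ.uncurry :=
    intervalIntegral.continuous_parametric_primitive_of_continuous hH
  have hΦc : Continuous Φ.uncurry := by
    have h1 : Continuous fun p : A × ℝ => ∫ s in (-R)..c p.2, F p.1 s :=
      intervalIntegral.continuous_parametric_intervalIntegral_of_continuous
        (f := fun p : A × ℝ => F p.1) (by fun_prop) (hcc.comp continuous_snd)
    have h2 : Continuous fun p : A × ℝ => ∫ s in (-R)..R, F p.1 s :=
      (intervalIntegral.continuous_parametric_intervalIntegral_of_continuous' hF _ _).comp
        continuous_fst
    have h3 : Continuous fun p : A × ℝ => ∫ s in (-k)..k, H p.1 s :=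
      (intervalIntegral.continuous_parametric_intervalIntegral_of_continuous' hH _ _).comp
        continuous_fst
    exact (h1.div h2 fun p => (hmF p.1).ne').mul h3
  have hΨm : ∀ a, StrictMono (Ψ a) := fun a y z hyz => by
    have := intervalIntegral.integral_add_adjacent_intervals (hHi a (-k) y) (hHi a y z)
    have h2 := intervalIntegral.intervalIntegral_pos_of_pos (hHi a _ _) (hHpos a) hyz
    simp only [hΨ]
    linarith
  -- `T a t` matches the two distribution functions, with that of `F a` rescaled to the mass of `H
  -- a`.
  have hex : ∀ a t, ∃ y ∈ Set.Icc (-k) k, Ψ a y = Φ a t := fun a t => by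
    have hiv := intermediate_value_Icc (f := Ψ a) (show -k ≤ k by linarith)
      (hΨc.comp (Continuous.prodMk_right a)).continuousOn
    refine hiv ⟨?_, ?_⟩
    · simp only [hΨ, hΦ, intervalIntegral.integral_same]
      exact mul_nonneg (div_nonneg (intervalIntegral.integral_nonneg (hcI t).1
        fun s _ => (hFpos a s).le) (hmF a).le) (hmH a).le
    · refine mul_le_of_le_one_left (hmH a).le ((div_le_one (hmF a)).2 ?_)
      have := intervalIntegral.integral_add_adjacent_intervals (hFi a (-R) (c t)) (hFi a (c t) R)
      have h2 : 0 ≤ ∫ s in c t..R, F a s :=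
        intervalIntegral.integral_nonneg (hcI t).2 fun s _ => (hFpos a s).le
      linarith
  choose T hTI hT using hex
  have hTc : Continuous T.uncurry := by
    refine continuous_iff_continuousAt.2 fun p => ?_
    refine (nhds_basis_Ioo (T.uncurry p)).tendsto_right_iff.2 fun b hb => ?_
    -- By strict monotonicity of `Ψ`, `T` lies in `(b.1, b.2)` exactly when `Φ` lies strictly
    -- between the values of `Ψ` at `b.1` and `b.2`, an open condition on the point; this gives
    -- joint continuity.
    have key : ∀ y, Continuous fun q : A × ℝ => Ψ q.1 y := fun y =>
      hΨc.comp (continuous_fst.prodMk continuous_const)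
    have h1 : ∀ᶠ q in 𝓝 p, Ψ q.1 b.1 < Φ.uncurry q :=
      (key b.1).continuousAt.eventually_lt hΦc.continuousAt
        (by rw [Function.uncurry, ← hT]; exact hΨm _ hb.1)
    have h2 : ∀ᶠ q in 𝓝 p, Φ.uncurry q < Ψ q.1 b.2 :=
      hΦc.continuousAt.eventually_lt (key b.2).continuousAt
        (by rw [Function.uncurry, ← hT]; exact hΨm _ hb.2)
    filter_upwards [h1, h2] with q hq1 hq2
    rw [Function.uncurry, ← hT] at hq1 hq2
    exact ⟨(hΨm _).lt_iff_lt.1 hq1, (hΨm _).lt_iff_lt.1 hq2⟩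
  refine ⟨T, hTc, hTI, fun a t ht => ?_⟩
  have hTa : Continuous (T a) := hTc.comp (Continuous.prodMk_right a)
  have hΨd : HasStrictDerivAt (Ψ a) (H a (T a t)) (T a t) :=
    intervalIntegral.integral_hasStrictDerivAt_right (hHi a _ _)
      ((hHc a).stronglyMeasurableAtFilter _ _) (hHc a).continuousAt
  have hne : H a (T a t) ≠ 0 := (hHpos _ _).ne'
  have hct : ∀ᶠ s in 𝓝 t, c s = s := by
    filter_upwards [Ioo_mem_nhds ht.1 ht.2] with s hs
    simp only [hc]
    rw [min_eq_right hs.2.le, max_eq_right hs.1.le]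
  have hΦd : HasDerivAt (Φ a)
      (F a t / (∫ s in (-R)..R, F a s) * ∫ s in (-k)..k, H a s) t := by
    have h0 : HasDerivAt (fun u => ∫ s in (-R)..u, F a s) (F a t) t :=
      intervalIntegral.integral_hasDerivAt_right (hFi a _ _)
        ((hFc a).stronglyMeasurableAtFilter _ _) (hFc a).continuousAt
    refine ((h0.div_const _).mul_const _).congr_of_eventuallyEq ?_
    filter_upwards [hct] with s hs
    simp only [hΦ, hs]
  have hinv := (hΨd.to_localInverse hne).hasDerivAt
  rw [hT a t] at hinv
  have hcomp := hinv.comp t hΦd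
  have heq : T a =ᶠ[𝓝 t] (hΨd.localInverse (Ψ a) _ _ hne) ∘ Φ a := by
    filter_upwards [hTa.continuousAt.eventually (hΨd.eventually_left_inverse hne)] with s hs
    rw [Function.comp_apply, ← hT a s, hs]
  refine (hcomp.congr_of_eventuallyEq heq).congr_deriv ?_
  field_simp

/-- Knothe's triangular transport between two families of positive continuous densities on cubes,
depending continuously on a parameter. The diagonal entries `D a x i` of its Jacobian matrix
multiply to the Jacobian determinant. -/
theorem exists_knothe_transport (n : ℕ) {R k : ℝ} (hR : 0 < R) (hk : 0 < k) :
    ∀ {A : Type} [TopologicalSpace A] [FirstCountableTopology A] [LocallyCompactSpace A]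
      {f h : A → (Fin n → ℝ) → ℝ}, Continuous f.uncurry → Continuous h.uncurry →
      (∀ a x, 0 < f a x) → (∀ a x, 0 < h a x) →
      ∃ T D : A → (Fin n → ℝ) → Fin n → ℝ, Continuous T.uncurry ∧ Continuous D.uncurry ∧
        (∀ a x, T a x ∈ cube n k) ∧ (∀ a x i, 0 < D a x i) ∧
        (∀ a x i, x i ∈ Set.Ioo (-R) R →
          HasDerivAt (fun t => T a (Function.update x i t) i) (D a x i) (x i)) ∧
        ∀ a x, ∏ i, D a x i
          = f a x / (∫ y in cube n R, f a y) * ((∫ y in cube n k, h a y) / h a (T a x)) := by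
  induction n with
  | zero =>
    intro A _ _ _ f h hf hh hfpos hhpos
    have hint : ∀ (r : ℝ) (u : (Fin 0 → ℝ) → ℝ), ∫ y in cube 0 r, u y = u 0 := fun r u => by
      have hc : cube 0 r = Set.univ := Set.eq_univ_of_forall fun x => mem_cube.2 fun i => i.elim0
      have hu : u = fun _ => u 0 := funext fun x => congrArg u (Subsingleton.elim _ _)
      rw [hc, hu, setIntegral_univ, integral_const]
      simp [Measure.real, volume_pi]
    refine ⟨fun _ _ => 0, fun _ _ => 0, continuous_const, continuous_const,
      fun a x => mem_cube.2 fun i => i.elim0, fun _ _ i => i.elim0, fun _ _ i => i.elim0,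
      fun a x => ?_⟩
    have h1 := (hfpos a 0).ne'
    have h2 := (hhpos a 0).ne'
    rw [hint, hint, Subsingleton.elim x 0]
    rw [Finset.univ_eq_empty, Finset.prod_empty, div_self h1, one_mul]
    exact (div_self h2).symm
  | succ n ih =>
    intro A _ _ _ f h hf hh hfpos hhpos
    have hfc : ∀ a, Continuous (f a) := fun a => hf.comp (Continuous.prodMk_right a)
    have hhc : ∀ a, Continuous (h a) := fun a => hh.comp (Continuous.prodMk_right a)
    have hins : ∀ t : ℝ, Continuous fun y : Fin n → ℝ =>
        (Fin.insertNth 0 t y : Fin (n + 1) → ℝ) := fun t =>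
      (continuous_insertNth 0).comp (Continuous.prodMk_right t)
    have hjoint : Continuous fun p : (A × ℝ) × (Fin n → ℝ) =>
        (p.1.1, (Fin.insertNth 0 p.1.2 p.2 : Fin (n + 1) → ℝ)) :=
      (continuous_fst.comp continuous_fst).prodMk
        ((continuous_insertNth 0).comp ((continuous_snd.comp continuous_fst).prodMk continuous_snd))
    set F : A → ℝ → ℝ := fun a t => ∫ y in cube n R, f a (Fin.insertNth 0 t y) with hF
    set H : A → ℝ → ℝ := fun a t => ∫ y in cube n k, h a (Fin.insertNth 0 t y) with hH
    have hFc : Continuous F.uncurry :=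
      continuous_parametric_integral_of_continuous
        (f := fun (p : A × ℝ) y => f p.1 (Fin.insertNth 0 p.2 y)) (hf.comp hjoint)
        (isCompact_cube n R)
    have hHc : Continuous H.uncurry :=
      continuous_parametric_integral_of_continuous
        (f := fun (p : A × ℝ) y => h p.1 (Fin.insertNth 0 p.2 y)) (hh.comp hjoint)
        (isCompact_cube n k)
    have hFpos : ∀ a t, 0 < F a t := fun a t =>
      setIntegral_cube_pos hR ((hfc a).comp (hins t)) fun y => hfpos a _
    have hHpos : ∀ a t, 0 < H a t := fun a t =>
      setIntegral_cube_pos hk ((hhc a).comp (hins t)) fun y => hhpos a _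
    have hmF : ∀ a, 0 < ∫ s in (-R)..R, F a s := fun a =>
      intervalIntegral.intervalIntegral_pos_of_pos
        ((hFc.comp (Continuous.prodMk_right a)).intervalIntegrable _ _) (hFpos a) (by linarith)
    have hmH : ∀ a, 0 < ∫ s in (-k)..k, H a s := fun a =>
      intervalIntegral.intervalIntegral_pos_of_pos
        ((hHc.comp (Continuous.prodMk_right a)).intervalIntegrable _ _) (hHpos a) (by linarith)
    obtain ⟨S, hSc, hSI, hSd⟩ := exists_monotone_transport hFc hHc hFpos hHpos hR hk
    -- The first coordinate becomes a parameter: the slice of `f` at `t` is transported to the slice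
    -- of `h` at `S a t`. This is why the statement carries a parameter space.
    obtain ⟨T, D, hTc, hDc, hTI, hDpos, hTd, hprod⟩ := ih
      (A := A × ℝ) (f := fun p y => f p.1 (Fin.insertNth 0 p.2 y))
      (h := fun p y => h p.1 (Fin.insertNth 0 (S p.1 p.2) y))
      (hf.comp hjoint)
      (hh.comp ((continuous_fst.comp continuous_fst).prodMk
        ((continuous_insertNth 0).comp ((hSc.comp continuous_fst).prodMk continuous_snd))))
      (fun p y => hfpos _ _) (fun p y => hhpos _ _)
    have hsplit : Continuous fun p : A × (Fin (n + 1) → ℝ) => ((p.1, p.2 0), Fin.tail p.2) := by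
      unfold Fin.tail
      fun_prop
    have hsplit' : Continuous fun p : A × (Fin (n + 1) → ℝ) => (p.1, p.2 0) := by
      fun_prop
    set D₀ : A → ℝ → ℝ := fun a t =>
      F a t / (∫ s in (-R)..R, F a s) * ((∫ s in (-k)..k, H a s) / H a (S a t)) with hD₀
    have hD₀c : Continuous D₀.uncurry := by
      have h2 : Continuous fun p : A × ℝ => ∫ s in (-R)..R, F p.1 s :=
        (intervalIntegral.continuous_parametric_intervalIntegral_of_continuous' hFc _ _).comp
          continuous_fst
      have h3 : Continuous fun p : A × ℝ => ∫ s in (-k)..k, H p.1 s :=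
        (intervalIntegral.continuous_parametric_intervalIntegral_of_continuous' hHc _ _).comp
          continuous_fst
      exact (hFc.div h2 fun p => (hmF p.1).ne').mul
        (h3.div (hHc.comp (continuous_fst.prodMk hSc)) fun p => (hHpos _ _).ne')
    refine ⟨fun a x => Fin.insertNth 0 (S a (x 0)) (T (a, x 0) (Fin.tail x)),
      fun a x => Fin.insertNth 0 (D₀ a (x 0)) (D (a, x 0) (Fin.tail x)),
      (continuous_insertNth 0).comp ((hSc.comp hsplit').prodMk (hTc.comp hsplit)),
      (continuous_insertNth 0).comp ((hD₀c.comp hsplit').prodMk (hDc.comp hsplit)),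
      fun a x => (insertNth_mem_cube _ _ _).2 ⟨hSI _ _, hTI _ _⟩, fun a x i => ?_,
      fun a x i hi => ?_, fun a x => ?_⟩
    · refine Fin.cases ?_ (fun j => ?_) i
      · simpa [Fin.insertNth_zero'] using
          mul_pos (div_pos (hFpos _ _) (hmF _)) (div_pos (hmH _) (hHpos _ _))
      · simpa [Fin.insertNth_zero'] using hDpos _ _ j
    · revert hi
      refine Fin.cases (fun hi => ?_) (fun j hi => ?_) i
      · simpa [Fin.insertNth_zero'] using hSd a (x 0) hi
      -- Triangularity: moving a later coordinate leaves `x 0`, hence the slice, unchanged.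
      · have hne : (0 : Fin (n + 1)) ≠ j.succ := (Fin.succ_ne_zero j).symm
        have := hTd (a, x 0) (Fin.tail x) j hi
        simpa [Fin.insertNth_zero', Function.update_of_ne hne] using! this
    · have hx : (Fin.insertNth 0 (x 0) (Fin.tail x) : Fin (n + 1) → ℝ) = x := by
        rw [Fin.insertNth_zero', Fin.cons_self_tail]
      rw [Fin.prod_univ_succ, setIntegral_cube_succ 0 hR.le (hfc a),
        setIntegral_cube_succ 0 hk.le (hhc a)]
      have := hprod (a, x 0) (Fin.tail x)
      simp only [hx] at this
      have h1 := (hFpos a (x 0)).ne'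
      have h2 := (hHpos a (S a (x 0))).ne'
      have e : ∀ j : Fin n, (Fin.insertNth 0 (D₀ a (x 0)) (D (a, x 0) (Fin.tail x)) :
          Fin (n + 1) → ℝ) j.succ = D (a, x 0) (Fin.tail x) j := fun j => by
        simp [Fin.insertNth_zero']
      simp_rw [e]
      rw [this]
      simp only [Fin.insertNth_apply_same]
      -- The slice masses `F a (x 0)` and `H a (S a (x 0))` cancel between the marginal and the
      -- conditional factors.
      change F a (x 0) / (∫ s in (-R)..R, F a s) * ((∫ s in (-k)..k, H a s) / H a (S a (x 0))) *
        (f a x / F a (x 0) * (H a (S a (x 0)) / _)) =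
        f a x / (∫ s in (-R)..R, F a s) * ((∫ s in (-k)..k, H a s) / _)
      field_simp

/-! ### Negative parts, flux through faces, and exhaustion by cubes. -/

/-- The arithmetic-geometric mean inequality in multiplicative form. -/
theorem card_mul_le_sum_of_pow_le_prod {n : ℕ} (hn : n ≠ 0) {c : ℝ} (hc : 0 ≤ c) {z : Fin n → ℝ}
    (hz : ∀ i, 0 ≤ z i) (h : c ^ n ≤ ∏ i, z i) : n * c ≤ ∑ i, z i := by
  have hn' : (0 : ℝ) < n := by positivity
  have key := Real.geom_mean_le_arith_mean Finset.univ (fun _ => (1 : ℝ)) z (fun _ _ => zero_le_one)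
    (by simpa using hn') (fun i _ => hz i)
  simp only [Real.rpow_one, Finset.sum_const, Finset.card_univ, Fintype.card_fin, nsmul_eq_mul,
    mul_one, one_mul] at key
  have h2 : c ≤ (∏ i, z i) ^ ((n : ℝ)⁻¹) := by
    calc c = (c ^ n) ^ ((n : ℝ)⁻¹) := (Real.pow_rpow_inv_natCast hc hn).symm
      _ ≤ _ := Real.rpow_le_rpow (by positivity) h (by positivity)
  have h3 := h2.trans key
  rwa [le_div_iff₀ hn', mul_comm] at h3

/-- If `u` is integrable and `u ≤ f`, then the integral of the negative part of `f` is controlled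
by that of its positive part and the integral of `u`. -/
theorem lintegral_neg_part_le {α : Type*} [MeasurableSpace α] {μ : Measure α} {f : α → EReal}
    {u : α → ℝ} (hu : Integrable u μ) (h : ∀ᵐ x ∂μ, (u x : EReal) ≤ f x) :
    ∫⁻ x, (-f x).toENNReal ∂μ
      ≤ ∫⁻ x, (f x).toENNReal ∂μ + ENNReal.ofReal (-∫ x, u x ∂μ) := by
  -- `f⁻ + u⁺ ≤ f⁺ + u⁻` needs no subtraction, and integrating it needs measurability of `u` only.
  have hpt : ∀ᵐ x ∂μ, (-f x).toENNReal + ENNReal.ofReal (u x)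
      ≤ (f x).toENNReal + ENNReal.ofReal (-u x) := by
    filter_upwards [h] with x hx
    induction hfx : f x with
    | bot => rw [hfx] at hx; simp at hx
    | top => simp
    | coe r =>
      rw [hfx, EReal.coe_le_coe_iff] at hx
      rw [← EReal.coe_neg, EReal.toENNReal_of_ne_top (EReal.coe_ne_top _),
        EReal.toENNReal_of_ne_top (EReal.coe_ne_top _), EReal.toReal_coe, EReal.toReal_coe,
        ENNReal.ofReal, ENNReal.ofReal, ENNReal.ofReal, ENNReal.ofReal, ← ENNReal.coe_add,
        ← ENNReal.coe_add, ENNReal.coe_le_coe, ← NNReal.coe_le_coe]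
      push_cast
      simp only [Real.coe_toNNReal']
      rcases max_cases (-r) 0 with h1 | h1 <;> rcases max_cases (u x) 0 with h2 | h2 <;>
      rcases max_cases (r) 0 with h3 | h3 <;> rcases max_cases (-u x) 0 with h4 | h4 <;> linarith
  have hP : ∫⁻ x, ENNReal.ofReal (u x) ∂μ ≠ ⊤ := hu.lintegral_lt_top.ne
  have hN : ∫⁻ x, ENNReal.ofReal (-u x) ∂μ ≠ ⊤ := hu.neg.lintegral_lt_top.ne
  have hm : AEMeasurable (fun x => ENNReal.ofReal (u x)) μ := hu.1.aemeasurable.ennreal_ofReal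
  have hm' : AEMeasurable (fun x => ENNReal.ofReal (-u x)) μ :=
    hu.1.aemeasurable.neg.ennreal_ofReal
  have hint := lintegral_mono_ae hpt
  rw [lintegral_add_right' _ hm, lintegral_add_right' _ hm'] at hint
  have hle : ∫⁻ x, ENNReal.ofReal (-u x) ∂μ
      ≤ ENNReal.ofReal (-∫ x, u x ∂μ) + ∫⁻ x, ENNReal.ofReal (u x) ∂μ := by
    rw [integral_eq_lintegral_pos_part_sub_lintegral_neg_part hu, neg_sub,
      ← ENNReal.ofReal_toReal hN, ← ENNReal.ofReal_toReal hP]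
    rw [ENNReal.toReal_ofReal ENNReal.toReal_nonneg, ENNReal.toReal_ofReal ENNReal.toReal_nonneg,
      ← ENNReal.ofReal_toReal hP, ENNReal.toReal_ofReal ENNReal.toReal_nonneg]
    refine le_trans (ENNReal.ofReal_le_ofReal ?_) ENNReal.ofReal_add_le
    linarith
  refine (ENNReal.add_le_add_iff_right hP).1 (hint.trans ?_)
  rw [add_assoc]
  exact add_le_add_right hle _

/-- Tonelli's theorem, singling out one coordinate. -/
theorem lintegral_insertNth {n : ℕ} (i : Fin (n + 1)) {u : (Fin (n + 1) → ℝ) → ENNReal}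
    (hu : Measurable u) : ∫⁻ t, ∫⁻ y, u (i.insertNth t y) = ∫⁻ x, u x := by
  have e := (volume_preserving_piFinSuccAbove (fun _ : Fin (n + 1) => ℝ) i).symm
  rw [← e.lintegral_comp hu, Measure.volume_eq_prod, lintegral_prod]
  · rfl
  · exact (hu.comp (MeasurableEquiv.measurable _)).aemeasurable

/-- The integrals of an integrable function over the boundaries of cubes are arbitrarily small for
suitable arbitrarily large cubes. -/
theorem exists_setIntegral_faces_le {n : ℕ} {φ : (Fin (n + 1) → ℝ) → ℝ} (hφ : Continuous φ)
    (hφ0 : ∀ x, 0 ≤ φ x) (hφi : Integrable φ) {ε : ℝ} (hε : 0 < ε) (R₀ : ℝ) :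
    ∃ R ≥ R₀, ∑ i : Fin (n + 1), ∫ y in cube n R, (φ (i.insertNth R y) + φ (i.insertNth (-R) y))
      ≤ ε := by
  set u : (Fin (n + 1) → ℝ) → ENNReal := fun x => ENNReal.ofReal (φ x) with hu
  have hum : Measurable u := hφ.measurable.ennreal_ofReal
  have hui : ∫⁻ x, u x ≠ ⊤ := hφi.lintegral_lt_top.ne
  have hins : ∀ (i : Fin (n + 1)) (t : ℝ), Continuous fun y : Fin n → ℝ =>
      (i.insertNth t y : Fin (n + 1) → ℝ) := fun i t =>
    (continuous_insertNth i).comp (Continuous.prodMk_right t)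
  set B : ℝ → ENNReal := fun R => ∑ i : Fin (n + 1),
    ((∫⁻ y : Fin n → ℝ, u (i.insertNth R y)) + ∫⁻ y : Fin n → ℝ, u (i.insertNth (-R) y)) with hB
  have hmeas : ∀ i : Fin (n + 1), Measurable fun R : ℝ => ∫⁻ y : Fin n → ℝ, u (i.insertNth R y) :=
    fun i => Measurable.lintegral_prod_right'
      (f := fun p : ℝ × (Fin n → ℝ) => u (i.insertNth p.1 p.2)) (hum.comp (continuous_insertNth i).measurable)
  have hBi : ∫⁻ R, B R ≠ ⊤ := by
    have hm2 : ∀ i ∈ (Finset.univ : Finset (Fin (n + 1))), Measurable fun R : ℝ =>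
        (∫⁻ y : Fin n → ℝ, u (i.insertNth R y)) + ∫⁻ y : Fin n → ℝ, u (i.insertNth (-R) y) :=
      fun i _ => (hmeas i).add ((hmeas i).comp measurable_neg)
    rw [hB, lintegral_finsetSum _ hm2]
    refine ENNReal.sum_ne_top.2 fun i _ => ?_
    rw [lintegral_add_left (hmeas i), lintegral_insertNth i hum]
    refine ENNReal.add_ne_top.2 ⟨hui, ?_⟩
    rw [lintegral_neg_eq_self (fun R : ℝ => ∫⁻ y : Fin n → ℝ, u (i.insertNth R y)),
      lintegral_insertNth i hum]
    exact hui
  -- Otherwise `B` exceeds `ε` on a half-line, contradicting its finite integral.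
  obtain ⟨R, hR, hBR⟩ : ∃ R ≥ R₀, B R ≤ ENNReal.ofReal ε := by
    by_contra! hcon
    refine hBi (top_unique ?_)
    calc (⊤ : ENNReal) = ∫⁻ _ in Set.Ici R₀, ENNReal.ofReal ε := by
          rw [setLIntegral_const, Real.volume_Ici, ENNReal.mul_top]
          simpa using hε
      _ ≤ ∫⁻ R in Set.Ici R₀, B R :=
          setLIntegral_mono' measurableSet_Ici fun R hR => (hcon R hR).le
      _ ≤ _ := setLIntegral_le_lintegral _ _
  refine ⟨R, hR, (ENNReal.ofReal_le_ofReal_iff hε.le).1 (le_trans ?_ hBR)⟩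
  rw [ENNReal.ofReal_sum_of_nonneg fun i _ => integral_nonneg fun y => add_nonneg (hφ0 _) (hφ0 _)]
  refine Finset.sum_le_sum fun i _ => ?_
  have hcont : Continuous fun y : Fin n → ℝ => φ (i.insertNth R y) + φ (i.insertNth (-R) y) :=
    (hφ.comp (hins i R)).add (hφ.comp (hins i (-R)))
  have hm3 : Measurable fun y : Fin n → ℝ => u (i.insertNth R y) :=
    hum.comp (hins i R).measurable
  rw [ofReal_integral_eq_lintegral_ofReal (hcont.integrableOn_cube R)
    (ae_of_all _ fun y => add_nonneg (hφ0 _) (hφ0 _)), ← lintegral_add_left hm3]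
  refine (setLIntegral_le_lintegral _ _).trans (lintegral_mono fun y => ?_)
  exact ENNReal.ofReal_add_le

/-- The divergence theorem on a cube for a field whose `i`-th component is differentiable in the
`i`-th variable. -/
theorem setIntegral_cube_divergence {n : ℕ} {R : ℝ} (hR : 0 ≤ R)
    {u u' : (Fin (n + 1) → ℝ) → Fin (n + 1) → ℝ} (hu : Continuous u) (hu' : Continuous u')
    (hd : ∀ x i, x i ∈ Set.Ioo (-R) R →
      HasDerivAt (fun t => u (Function.update x i t) i) (u' x i) (x i)) :
    ∫ x in cube (n + 1) R, ∑ i, u' x i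
      = ∑ i : Fin (n + 1), ∫ y in cube n R,
          (u (i.insertNth R y) i - u (i.insertNth (-R) y) i) := by
  have hi : ∀ i ∈ Finset.univ, IntegrableOn (fun x => u' x i) (cube (n + 1) R) := fun i _ =>
    Continuous.integrableOn_cube ((continuous_apply i).comp hu') R
  rw [integral_finsetSum _ hi]
  exact Finset.sum_congr rfl fun i _ => setIntegral_cube_partialDeriv i hR
    (u := fun x => u x i) ((continuous_apply i).comp hu) ((continuous_apply i).comp hu')
    fun x hx => hd x i hx

theorem cube_mono (n : ℕ) : Monotone (cube n) := fun _ _ h =>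
  Set.Icc_subset_Icc (fun _ => neg_le_neg h) fun _ => h

theorem iUnion_cube (n : ℕ) : ⋃ N : ℕ, cube n N = Set.univ := by
  refine Set.eq_univ_of_forall fun x => Set.mem_iUnion.2 ?_
  obtain ⟨N, hN⟩ := exists_nat_ge ‖x‖
  exact ⟨N, mem_cube.2 fun i => abs_le.1 ((norm_le_pi_norm x i).trans hN)⟩

theorem lintegral_le_of_forall_cube {n : ℕ} {u : (Fin n → ℝ) → ENNReal} {c : ENNReal}
    (h : ∀ N : ℕ, ∫⁻ x in cube n N, u x ≤ c) : ∫⁻ x, u x ≤ c := by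
  rw [← setLIntegral_univ, ← iUnion_cube n, setLIntegral_iUnion_of_directed]
  · exact iSup_le h
  · exact Monotone.directed_le fun M N hMN => cube_mono n (Nat.cast_le.2 hMN)

/-- Lowering `W` by a constant makes the mass of `1 / Wⁿ` exceed its total on a large cube. -/
theorem exists_cube_le_setIntegral {n : ℕ} {W : (Fin n → ℝ) → ℝ} (hn : n ≠ 0) (hW : Continuous W)
    {c δ : ℝ} (hδ : 0 < δ) (hδc : 2 * δ ≤ c) (hc : ∀ x, c ≤ W x)
    (hWi : Integrable fun x => 1 / W x ^ n) :
    ∃ k > 0, ∫ x, 1 / W x ^ n ≤ ∫ x in cube n k, 1 / (W x - δ) ^ n := by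
  have hpos : ∀ x, 0 < W x - δ := fun x => by linarith [hc x]
  have hcont : Continuous fun x => 1 / (W x - δ) ^ n :=
    continuous_const.div ((hW.sub continuous_const).pow n) fun x => (pow_pos (hpos x) n).ne'
  have hint : Integrable fun x => 1 / (W x - δ) ^ n := by
    refine (hWi.const_mul (2 ^ n)).mono' hcont.aestronglyMeasurable (ae_of_all _ fun x => ?_)
    have hx := hpos x
    rw [Real.norm_of_nonneg (by positivity), mul_one_div, div_le_div_iff₀ (by positivity)
      (pow_pos (by linarith) n), one_mul, ← mul_pow]
    exact pow_le_pow_left₀ (by linarith) (by linarith [hc x]) n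
  have hlt : ∫ x, 1 / W x ^ n < ∫ x, 1 / (W x - δ) ^ n := by
    rw [← sub_pos, ← integral_sub hint hWi]
    have hp : ∀ x, 0 < 1 / (W x - δ) ^ n - 1 / W x ^ n := fun x => by
      rw [sub_pos]
      exact one_div_lt_one_div_of_lt (pow_pos (hpos x) n)
        (pow_lt_pow_left₀ (by linarith) (hpos x).le hn)
    rw [integral_pos_iff_support_of_nonneg (fun x => (hp x).le) (hint.sub hWi)]
    rw [show Function.support (fun x => 1 / (W x - δ) ^ n - 1 / W x ^ n) = Set.univ from
      Set.eq_univ_of_forall fun x => (hp x).ne']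
    exact Measure.measure_univ_pos.2 (NeZero.ne _)
  have htend := tendsto_setIntegral_of_monotone (μ := volume) (s := fun N : ℕ => cube n N)
    (f := fun x => 1 / (W x - δ) ^ n) (fun N => measurableSet_cube n N)
    (fun M N hMN => cube_mono n (Nat.cast_le.2 hMN)) hint.integrableOn
  rw [iUnion_cube, setIntegral_univ] at htend
  obtain ⟨N, hN, hN0⟩ := ((htend.eventually_const_lt hlt).and (eventually_gt_atTop 0)).exists
  exact ⟨N, by exact_mod_cast hN0, hN.le⟩

/-! ### The two inequalities in coordinates. -/

/-- One summand of `div (T / Gⁿ⁺¹)`; in the applications `n + 1` is the dimension. -/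
theorem HasDerivAt.one_div_pow_mul {G T : ℝ → ℝ} {G' T' x : ℝ} (hG : HasDerivAt G G' x)
    (hT : HasDerivAt T T' x) (hx : G x ≠ 0) (n : ℕ) :
    HasDerivAt (fun t => T t * (1 / G t ^ (n + 1)))
      (T' * (1 / G x ^ (n + 1)) - (n + 1) * (T x * G' / G x ^ (n + 2))) x := by
  have h := hT.fun_mul ((hasDerivAt_const x (1 : ℝ)).fun_div (hG.fun_pow (n + 1))
    (pow_ne_zero _ hx))
  refine h.congr_deriv ?_
  simp only [Nat.add_sub_cancel]
  push_cast
  field_simp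
  ring

/-- Pairing the gradient of `G` with the Knothe transport of `1 / Gⁿ` to `1 / Vⁿ` on cubes, up to a
boundary term. -/
theorem exists_transport_bound {n : ℕ} {G V : (Fin (n + 1) → ℝ) → ℝ}
    {G' : (Fin (n + 1) → ℝ) → Fin (n + 1) → ℝ} (hG : Continuous G) (hG' : Continuous G')
    (hGd : ∀ x i, HasDerivAt (fun t => G (Function.update x i t)) (G' x i) (x i))
    (hGpos : ∀ x, 0 < G x) (hV : Continuous V) (hVpos : ∀ x, 0 < V x) {R k : ℝ} (hR : 0 < R)
    (hk : 0 < k)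
    (hmass : ∫ x in cube (n + 1) R, 1 / G x ^ (n + 1) ≤ ∫ x in cube (n + 1) k, 1 / V x ^ (n + 1)) :
    ∃ (T : (Fin (n + 1) → ℝ) → Fin (n + 1) → ℝ) (w : (Fin (n + 1) → ℝ) → ℝ), Continuous w ∧
      (∀ x, w x ≤ (∑ i, G' x i * T x i - V (T x)) / G x ^ (n + 2)) ∧
      -∫ x in cube (n + 1) R, w x ≤ k * ∑ i : Fin (n + 1), ∫ y in cube n R,
        (1 / G (i.insertNth R y) ^ (n + 1) + 1 / G (i.insertNth (-R) y) ^ (n + 1)) := by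
  have hφ : Continuous fun x => 1 / G x ^ (n + 1) :=
    continuous_const.div (hG.pow _) fun x => (pow_pos (hGpos x) _).ne'
  have hψ : Continuous fun x => 1 / V x ^ (n + 1) :=
    continuous_const.div (hV.pow _) fun x => (pow_pos (hVpos x) _).ne'
  have hφpos : ∀ x, 0 < 1 / G x ^ (n + 1) := fun x => one_div_pos.2 (pow_pos (hGpos x) _)
  have hψpos : ∀ x, 0 < 1 / V x ^ (n + 1) := fun x => one_div_pos.2 (pow_pos (hVpos x) _)
  obtain ⟨T, D, hTc, hDc, hTI, hDpos, hTd, hprod⟩ := exists_knothe_transport (n + 1) hR hk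
    (A := Unit) (f := fun _ x => 1 / G x ^ (n + 1)) (h := fun _ x => 1 / V x ^ (n + 1))
    (hφ.comp continuous_snd) (hψ.comp continuous_snd) (fun _ => hφpos) (fun _ => hψpos)
  replace hTc : Continuous (T ()) := hTc.comp (Continuous.prodMk_right ())
  replace hDc : Continuous (D ()) := hDc.comp (Continuous.prodMk_right ())
  replace hTI := hTI ()
  replace hDpos := hDpos ()
  replace hTd := hTd ()
  replace hprod := hprod ()
  set T := T ()
  set D := D ()
  have hn : (0 : ℝ) < (n : ℝ) + 1 := by positivity
  have hsum : ∀ x, (n + 1) * (V (T x) / G x) ≤ ∑ i, D x i := fun x => by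
    have h1 := hGpos x
    have h2 := hVpos (T x)
    have := card_mul_le_sum_of_pow_le_prod (n := n + 1) (by simp) (c := V (T x) / G x)
      (by positivity) (z := D x) (fun i => (hDpos x i).le) (by
        rw [hprod x]
        have ha := setIntegral_cube_pos hR hφ hφpos
        -- The Jacobian is `(V(T)/G)ⁿ⁺¹` times the ratio of target mass to source mass, which is at
        -- least one by `hmass`.
        rw [div_mul_div_comm, mul_comm (∫ x in cube (n + 1) R, _), ← div_mul_div_comm, div_pow]
        refine le_of_eq_of_le ?_ (le_mul_of_one_le_right (by positivity) ((one_le_div ha).2 hmass))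
        field_simp)
    exact_mod_cast this
  set u : (Fin (n + 1) → ℝ) → Fin (n + 1) → ℝ := fun x i => T x i * (1 / G x ^ (n + 1)) with hu
  set u' : (Fin (n + 1) → ℝ) → Fin (n + 1) → ℝ := fun x i =>
    D x i * (1 / G x ^ (n + 1)) - (n + 1) * (T x i * G' x i / G x ^ (n + 2)) with hu'
  have hTi : ∀ i, Continuous fun x => T x i := fun i => (continuous_apply i).comp hTc
  have hDi : ∀ i, Continuous fun x => D x i := fun i => (continuous_apply i).comp hDc
  have hGi : ∀ i, Continuous fun x => G' x i := fun i => (continuous_apply i).comp hG'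
  have huc : Continuous u := continuous_pi fun i => (hTi i).mul hφ
  have huc' : Continuous u' := continuous_pi fun i => ((hDi i).mul hφ).sub
    (continuous_const.mul (((hTi i).mul (hGi i)).div (hG.pow _)
      fun x => (pow_pos (hGpos x) _).ne'))
  have hdiv := setIntegral_cube_divergence hR.le huc huc' fun x i hi => by
    have := (hGd x i).one_div_pow_mul (hTd x i hi) (by simpa using (hGpos x).ne') n
    simpa [hu, hu'] using this
  -- The minorant `w` is `-div (T / Gⁿ⁺¹) / (n + 1)`: `hsum` gives the pointwise bound, and its
  -- integral is a pure boundary term.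
  refine ⟨T, fun x => -(1 / (n + 1)) * ∑ i, u' x i, ?_, fun x => ?_, ?_⟩
  · exact continuous_const.mul (continuous_finsetSum _ fun i _ => (continuous_apply i).comp huc')
  · have h1 := hGpos x
    have h2 : ∑ i, u' x i = (∑ i, D x i) * (1 / G x ^ (n + 1)) -
        (n + 1) * ((∑ i, G' x i * T x i) / G x ^ (n + 2)) := by
      simp only [hu', Finset.sum_sub_distrib, Finset.sum_mul, Finset.sum_div, Finset.mul_sum]
      congr 1
      exact Finset.sum_congr rfl fun i _ => by ring
    have h3 := mul_le_mul_of_nonneg_right (hsum x) (hφpos x).le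
    beta_reduce
    rw [h2]
    have h4 : (n + 1) * (V (T x) / G x) * (1 / G x ^ (n + 1)) =
        (n + 1) * (V (T x) / G x ^ (n + 2)) := by
      field_simp
      ring
    rw [h4] at h3
    rw [← sub_nonneg]
    have : 0 ≤ ((n : ℝ) + 1)⁻¹ * ((∑ i, D x i) * (1 / G x ^ (n + 1)) -
        (n + 1) * (V (T x) / G x ^ (n + 2))) :=
      mul_nonneg (by positivity) (by linarith)
    refine this.trans_eq ?_
    field_simp
    ring
  · rw [integral_const_mul, hdiv, neg_mul, neg_neg]
    have hface : ∀ i : Fin (n + 1), ∫ y in cube n R,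
        (u (i.insertNth R y) i - u (i.insertNth (-R) y) i) ≤ k * ∫ y in cube n R,
        (1 / G (i.insertNth R y) ^ (n + 1) + 1 / G (i.insertNth (-R) y) ^ (n + 1)) := fun i => by
      have hins : ∀ t : ℝ, Continuous fun y : Fin n → ℝ =>
          (i.insertNth t y : Fin (n + 1) → ℝ) := fun t =>
        (continuous_insertNth i).comp (Continuous.prodMk_right t)
      have hui : Continuous fun x => u x i := (continuous_apply i).comp huc
      rw [← integral_const_mul]
      refine setIntegral_mono
        (Continuous.integrableOn_cube ((hui.comp (hins R)).sub (hui.comp (hins (-R)))) R)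
        (Continuous.integrableOn_cube
          (continuous_const.mul ((hφ.comp (hins R)).add (hφ.comp (hins (-R))))) R) fun y => ?_
      have h1 := mul_le_mul_of_nonneg_right (mem_cube.1 (hTI (i.insertNth R y)) i).2
        (hφpos (i.insertNth R y)).le
      have h2 := mul_le_mul_of_nonneg_right (mem_cube.1 (hTI (i.insertNth (-R) y)) i).1
        (hφpos (i.insertNth (-R) y)).le
      simp only [hu]
      linarith
    have h0 : 0 ≤ k * ∑ i : Fin (n + 1), ∫ y in cube n R,
        (1 / G (i.insertNth R y) ^ (n + 1) + 1 / G (i.insertNth (-R) y) ^ (n + 1)) :=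
      mul_nonneg hk.le (Finset.sum_nonneg fun i _ => integral_nonneg fun y =>
        add_nonneg (hφpos _).le (hφpos _).le)
    calc 1 / ((n : ℝ) + 1) * _ ≤ 1 / ((n : ℝ) + 1) * (k * ∑ i : Fin (n + 1), ∫ y in cube n R,
        (1 / G (i.insertNth R y) ^ (n + 1) + 1 / G (i.insertNth (-R) y) ^ (n + 1))) := by
          refine mul_le_mul_of_nonneg_left ?_ (by positivity)
          rw [Finset.mul_sum]
          exact Finset.sum_le_sum fun i _ => hface i
      _ ≤ _ := mul_le_of_le_one_left h0 ((div_le_one hn).2 (by linarith [n.cast_nonneg (α := ℝ)]))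

/-- The main inequality in coordinates, for any `f` that dominates all the functions
`(∇G · y - W y) / Gⁿ⁺¹`. -/
theorem lintegral_neg_part_le_pos_part {n : ℕ} {G W : (Fin (n + 1) → ℝ) → ℝ}
    {G' : (Fin (n + 1) → ℝ) → Fin (n + 1) → ℝ} (hG : Continuous G) (hG' : Continuous G')
    (hGd : ∀ x i, HasDerivAt (fun t => G (Function.update x i t)) (G' x i) (x i))
    (hGpos : ∀ x, 0 < G x) (hW : Continuous W) {c : ℝ} (hc : 0 < c) (hWc : ∀ x, c ≤ W x)
    (hGi : Integrable fun x => 1 / G x ^ (n + 1)) (hGi' : Integrable fun x => 1 / G x ^ (n + 2))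
    (hWi : Integrable fun x => 1 / W x ^ (n + 1))
    (hmass : ∫ x, 1 / G x ^ (n + 1) ≤ ∫ x, 1 / W x ^ (n + 1)) {f : (Fin (n + 1) → ℝ) → EReal}
    (hf : ∀ x y, (((∑ i, G' x i * y i - W y) / G x ^ (n + 2) : ℝ) : EReal) ≤ f x) :
    ∫⁻ x, (-f x).toENNReal ≤ ∫⁻ x, (f x).toENNReal := by
  have hφ : Continuous fun x => 1 / G x ^ (n + 1) :=
    continuous_const.div (hG.pow _) fun x => (pow_pos (hGpos x) _).ne'
  have hφ' : Continuous fun x => 1 / G x ^ (n + 2) :=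
    continuous_const.div (hG.pow _) fun x => (pow_pos (hGpos x) _).ne'
  have hφpos : ∀ x, 0 ≤ 1 / G x ^ (n + 1) := fun x => one_div_nonneg.2 (pow_pos (hGpos x) _).le
  have hφpos' : ∀ x, 0 ≤ 1 / G x ^ (n + 2) := fun x => one_div_nonneg.2 (pow_pos (hGpos x) _).le
  refine _root_.le_of_forall_pos_le_add fun η hη => ?_
  obtain ⟨ε, hε, hεη⟩ : ∃ ε : ℝ, 0 < ε ∧ ENNReal.ofReal ε ≤ η := by
    obtain ⟨r, hr0, hr⟩ := ENNReal.lt_iff_exists_nnreal_btwn.1 hη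
    exact ⟨r, by exact_mod_cast hr0, by simpa using hr.le⟩
  set C := ∫ x, 1 / G x ^ (n + 2) with hC
  have hC0 : 0 ≤ C := integral_nonneg hφpos'
  -- The first bound keeps `W - δ ≥ W / 2`; the second makes the cost `δ * C` at most `ε / 2`, with
  -- `C + 1` ensuring a positive denominator.
  set δ := min (c / 2) (ε / (2 * (C + 1))) with hδ
  have hδ0 : 0 < δ := lt_min (by positivity) (by positivity)
  have hδC : δ * C ≤ ε / 2 := by
    calc δ * C ≤ ε / (2 * (C + 1)) * (C + 1) :=
          mul_le_mul (min_le_right _ _) (by linarith) hC0 (by positivity)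
      _ = ε / 2 := by field_simp
  have hδc : 2 * δ ≤ c := by linarith [min_le_left (c / 2) (ε / (2 * (C + 1)))]
  obtain ⟨k, hk, hkmass⟩ := exists_cube_le_setIntegral (by simp) hW hδ0 hδc hWc hWi
  refine lintegral_le_of_forall_cube fun N => ?_
  -- `R` is chosen after `k`, since the flux bound carries the factor `k`.
  obtain ⟨R, hR, hface⟩ := exists_setIntegral_faces_le hφ hφpos hGi
    (ε := ε / (2 * k)) (by positivity) (max N 1)
  have hR0 : 0 < R := lt_of_lt_of_le one_pos ((le_max_right _ _).trans hR)
  obtain ⟨T, w, hwc, hw, hwint⟩ := exists_transport_bound hG hG' hGd hGpos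
    (V := fun x => W x - δ) (hW.sub continuous_const) (fun x => by linarith [hWc x]) hR0 hk
    (((setIntegral_le_integral hGi (ae_of_all _ hφpos)).trans hmass).trans hkmass)
  have hui : IntegrableOn (fun x => w x - δ * (1 / G x ^ (n + 2))) (cube (n + 1) R) :=
    (hwc.sub (continuous_const.mul hφ')).integrableOn_cube R
  have hle := lintegral_neg_part_le (f := f) hui (ae_of_all _ fun x => by
    refine le_trans (EReal.coe_le_coe_iff.2 ?_) (hf x (T x))
    have := hw x
    rw [sub_div, sub_div] at this
    rw [sub_div, mul_one_div]
    linarith)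
  have hint : -∫ x in cube (n + 1) R, (w x - δ * (1 / G x ^ (n + 2))) ≤ ε := by
    rw [integral_sub (hwc.integrableOn_cube R)
      ((hφ'.integrableOn_cube R).integrable.const_mul δ), integral_const_mul]
    have h1 : ∫ x in cube (n + 1) R, 1 / G x ^ (n + 2) ≤ C :=
      setIntegral_le_integral hGi' (ae_of_all _ hφpos')
    have h2 := mul_le_mul_of_nonneg_left h1 hδ0.le
    have h3 := mul_le_mul_of_nonneg_left hface hk.le
    have h4 : k * (ε / (2 * k)) = ε / 2 := by field_simp
    linarith
  calc ∫⁻ x in cube (n + 1) N, (-f x).toENNReal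
      ≤ ∫⁻ x in cube (n + 1) R, (-f x).toENNReal :=
        lintegral_mono_set (cube_mono _ ((le_max_left _ _).trans hR))
    _ ≤ _ := hle
    _ ≤ _ := add_le_add (setLIntegral_le_lintegral _ _)
        ((ENNReal.ofReal_le_ofReal hint).trans hεη)

/-- The integral of `(∇G · x - G) / Gⁿ⁺¹` is nonpositive: the integrand is a multiple of the
divergence of the outward field `x / Gⁿ`. -/
theorem lintegral_pos_part_le_neg_part {n : ℕ} {G : (Fin (n + 1) → ℝ) → ℝ}
    {G' : (Fin (n + 1) → ℝ) → Fin (n + 1) → ℝ} (hG : Continuous G) (hG' : Continuous G')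
    (hGd : ∀ x i, HasDerivAt (fun t => G (Function.update x i t)) (G' x i) (x i))
    (hGpos : ∀ x, 0 < G x) {f : (Fin (n + 1) → ℝ) → EReal}
    (hf : ∀ x, f x = (((∑ i, G' x i * x i - G x) / G x ^ (n + 2) : ℝ) : EReal)) :
    ∫⁻ x, (f x).toENNReal ≤ ∫⁻ x, (-f x).toENNReal := by
  refine lintegral_le_of_forall_cube fun N => ?_
  have hφ : Continuous fun x => 1 / G x ^ (n + 1) :=
    continuous_const.div (hG.pow _) fun x => (pow_pos (hGpos x) _).ne'
  have hφpos : ∀ x, 0 < 1 / G x ^ (n + 1) := fun x => one_div_pos.2 (pow_pos (hGpos x) _)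
  set u : (Fin (n + 1) → ℝ) → Fin (n + 1) → ℝ := fun x i => x i * (1 / G x ^ (n + 1)) with hu
  set u' : (Fin (n + 1) → ℝ) → Fin (n + 1) → ℝ := fun x i =>
    1 * (1 / G x ^ (n + 1)) - (n + 1) * (x i * G' x i / G x ^ (n + 2)) with hu'
  have hGi : ∀ i, Continuous fun x => G' x i := fun i => (continuous_apply i).comp hG'
  have huc : Continuous u := continuous_pi fun i => (continuous_apply i).mul hφ
  have huc' : Continuous u' := continuous_pi fun i => (continuous_const.mul hφ).sub
    (continuous_const.mul (((continuous_apply i).mul (hGi i)).div (hG.pow _)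
      fun x => (pow_pos (hGpos x) _).ne'))
  have hN : (0 : ℝ) ≤ N := N.cast_nonneg
  have hdiv := setIntegral_cube_divergence hN huc huc' fun x i hi => by
    have hid : HasDerivAt (fun t => Function.update x i t i) 1 (x i) := by
      simpa using hasDerivAt_id' (x i)
    have := (hGd x i).one_div_pow_mul hid (by simpa using (hGpos x).ne') n
    simpa [hu, hu'] using this
  have hvc : Continuous fun x => (1 / ((n : ℝ) + 1)) * ∑ i, u' x i :=
    continuous_const.mul (continuous_finsetSum _ fun i _ => (continuous_apply i).comp huc')
  have hle := lintegral_neg_part_le (f := fun x => -f x) (hvc.integrableOn_cube N)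
    (ae_of_all _ fun x => le_of_eq (by
      rw [hf x, ← EReal.coe_neg, EReal.coe_eq_coe_iff]
      have h2 : ∑ i, u' x i = (n + 1) * (1 / G x ^ (n + 1)) -
          (n + 1) * ((∑ i, G' x i * x i) / G x ^ (n + 2)) := by
        simp only [hu', Finset.sum_sub_distrib, Finset.sum_div, Finset.mul_sum]
        congr 1
        · simp
        · exact Finset.sum_congr rfl fun i _ => by ring
      have h1 := hGpos x
      rw [h2]
      field_simp
      ring))
  simp only [neg_neg] at hle
  -- On the two faces normal to `i`, `x i` is `N` and `-N`, so both contribute outward flux.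
  have h0 : 0 ≤ ∫ x in cube (n + 1) N, (1 / ((n : ℝ) + 1)) * ∑ i, u' x i := by
    rw [integral_const_mul, hdiv]
    refine mul_nonneg (by positivity) (Finset.sum_nonneg fun i _ => integral_nonneg fun y => ?_)
    have h1 := mul_nonneg hN (hφpos (i.insertNth (N : ℝ) y)).le
    have h2 := mul_nonneg hN (hφpos (i.insertNth (-N : ℝ) y)).le
    simp only [hu, Fin.insertNth_apply_same, Pi.zero_apply]
    linarith
  rw [ENNReal.ofReal_of_nonpos (neg_nonpos.2 h0), add_zero] at hle
  exact hle.trans (setLIntegral_le_lintegral _ _)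

/-! ### The Legendre transform and convexity. -/

theorem le_legendreTransform {n : ℕ} (W : EuclideanSpace ℝ (Fin n) → ℝ)
    (x y : EuclideanSpace ℝ (Fin n)) :
    ((inner ℝ x y - W y : ℝ) : EReal) ≤ legendreTransform W x :=
  le_iSup (fun y => ((inner ℝ x y - W y : ℝ) : EReal)) y

/-- The supremum is uncountable, but a supremum of continuous functions is lower semicontinuous. -/
theorem measurable_legendreTransform {n : ℕ} (W : EuclideanSpace ℝ (Fin n) → ℝ) :
    Measurable (legendreTransform W) := by
  refine LowerSemicontinuous.measurable (lowerSemicontinuous_iSup fun y => ?_)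
  refine Continuous.lowerSemicontinuous (continuous_coe_real_ereal.comp ?_)
  fun_prop

/-- The tangent plane inequality for a differentiable convex function. -/
theorem ConvexOn.add_inner_gradient_le {E : Type*} [NormedAddCommGroup E] [InnerProductSpace ℝ E]
    [CompleteSpace E] {W : E → ℝ} (hW : ConvexOn ℝ Set.univ W) {x : E}
    (hd : DifferentiableAt ℝ W x) (y : E) : W x + inner ℝ (∇ W x) (y - x) ≤ W y := by
  have hline : HasDerivAt (fun t : ℝ => AffineMap.lineMap (k := ℝ) x y t) (y - x) 0 :=
    AffineMap.hasDerivAt_lineMap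
  have h1 : HasDerivAt (fun t : ℝ => W (AffineMap.lineMap x y t)) (fderiv ℝ W x (y - x)) 0 := by
    refine HasFDerivAt.comp_hasDerivAt (l := W) (0 : ℝ) ?_ hline
    simpa using hd.hasFDerivAt
  have h2 := (hW.comp_affineMap (AffineMap.lineMap x y)).le_slope_of_hasDerivAt
    (x := 0) (y := 1) (by simp) (by simp) one_pos h1
  rw [slope_def_field] at h2
  simp only [Function.comp_apply, AffineMap.lineMap_apply_one, AffineMap.lineMap_apply_zero,
    sub_zero, div_one] at h2
  rw [inner_gradient_left]
  linarith

/-- The equality case of the Fenchel–Young inequality for a differentiable convex function. -/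
theorem legendreTransform_gradient {n : ℕ} {W : EuclideanSpace ℝ (Fin n) → ℝ}
    (hW : ConvexOn ℝ Set.univ W) {x : EuclideanSpace ℝ (Fin n)} (hd : DifferentiableAt ℝ W x) :
    legendreTransform W (∇ W x) = ((inner ℝ (∇ W x) x - W x : ℝ) : EReal) := by
  refine le_antisymm (iSup_le fun y => EReal.coe_le_coe_iff.2 ?_) (le_legendreTransform W _ x)
  have := hW.add_inner_gradient_le hd y
  rw [inner_sub_right] at this
  linarith

/-- A positive continuous function tending to infinity is bounded below by a positive constant. -/
theorem exists_pos_forall_le {X : Type*} [TopologicalSpace X] [Nonempty X] {g : X → ℝ}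
    (hg : Continuous g) (hpos : ∀ x, 0 < g x) (hlim : Tendsto g (cocompact X) atTop) :
    ∃ c > 0, ∀ x, c ≤ g x := by
  obtain ⟨x₀, hx₀⟩ := hg.exists_forall_le hlim
  exact ⟨g x₀, hpos x₀, hx₀⟩

/-! ### Transfer from coordinates to Euclidean space, and the theorem. -/

theorem hasDerivAt_update_toLp {n : ℕ} {g : EuclideanSpace ℝ (Fin n) → ℝ}
    (hg : Differentiable ℝ g) (x : Fin n → ℝ) (i : Fin n) :
    HasDerivAt (fun t => g (WithLp.toLp 2 (Function.update x i t))) (∇ g (WithLp.toLp 2 x) i)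
      (x i) := by
  have h1 : HasDerivAt (fun t => WithLp.toLp 2 (Function.update x i t))
      (EuclideanSpace.single i (1 : ℝ)) (x i) := by
    have := ((PiLp.continuousLinearEquiv 2 ℝ (fun _ : Fin n => ℝ)).symm :
      (Fin n → ℝ) →L[ℝ] EuclideanSpace ℝ (Fin n)).hasFDerivAt.comp_hasDerivAt (x i)
      (hasDerivAt_update x i (x i))
    exact this
  have h2 := HasFDerivAt.comp_hasDerivAt (l := g) (x i)
    (by simpa using (hg (WithLp.toLp 2 x)).hasFDerivAt) h1
  rw [← inner_gradient_left, EuclideanSpace.inner_single_right] at h2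
  simpa using! h2

theorem lintegral_toLp {n : ℕ} (u : EuclideanSpace ℝ (Fin n) → ENNReal) :
    ∫⁻ x : Fin n → ℝ, u (WithLp.toLp 2 x) = ∫⁻ x, u x :=
  (PiLp.volume_preserving_toLp (Fin n)).lintegral_comp_emb
    (MeasurableEquiv.toLp 2 (Fin n → ℝ)).measurableEmbedding u

theorem integral_toLp {n : ℕ} (u : EuclideanSpace ℝ (Fin n) → ℝ) :
    ∫ x : Fin n → ℝ, u (WithLp.toLp 2 x) = ∫ x, u x :=
  (PiLp.volume_preserving_toLp (Fin n)).integral_comp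
    (MeasurableEquiv.toLp 2 (Fin n → ℝ)).measurableEmbedding u

theorem theorem1p1 (n : ℕ) (hn : 1 ≤ n) (g W : EuclideanSpace ℝ (Fin n) → ℝ)
    (hg_smooth : ContDiff ℝ ∞ g) (hW_smooth : ContDiff ℝ ∞ W)
    (hg_pos : ∀ x, 0 < g x) (hW_pos : ∀ x, 0 < W x)
    (hg_lim : Tendsto g (cocompact (EuclideanSpace ℝ (Fin n))) atTop)
    (hW_lim : Tendsto W (cocompact (EuclideanSpace ℝ (Fin n))) atTop)
    (hg_grad : Tendsto (fun x => ‖∇ g x‖) (cocompact (EuclideanSpace ℝ (Fin n))) atTop)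
    (hW_grad : Tendsto (fun x => ‖∇ W x‖) (cocompact (EuclideanSpace ℝ (Fin n))) atTop)
    (hg_int : ∫ x, 1 / g x ^ n = 1) (hW_int : ∫ x, 1 / W x ^ n = 1) :
    HasIntegralAboveBot volume
        (fun x => legendreTransform W (∇ g x) / ((g x ^ (n + 1) : ℝ) : EReal)) ∧
      0 ≤ extendedIntegral volume
        (fun x => legendreTransform W (∇ g x) / ((g x ^ (n + 1) : ℝ) : EReal)) ∧
      (g = W → ConvexOn ℝ Set.univ g →
        extendedIntegral volume
          (fun x => legendreTransform W (∇ g x) / ((g x ^ (n + 1) : ℝ) : EReal)) = 0) := by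
  obtain ⟨n, rfl⟩ : ∃ m, n = m + 1 := ⟨n - 1, by omega⟩
  have hgd : Differentiable ℝ g := hg_smooth.differentiable (by simp)
  have hgc : Continuous g := hg_smooth.continuous
  have hWc : Continuous W := hW_smooth.continuous
  have hgradc : Continuous (∇ g) :=
    (InnerProductSpace.toDual ℝ _).symm.continuous.comp (hg_smooth.continuous_fderiv (by simp))
  obtain ⟨b, hb, hgb⟩ := exists_pos_forall_le hgc hg_pos hg_lim
  obtain ⟨c, hc, hWb⟩ := exists_pos_forall_le hWc hW_pos hW_lim
  -- A non-integrable function has integral `0` by convention, so the value `1` forces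
  -- integrability.
  have hgi : Integrable fun x => 1 / g x ^ (n + 1) :=
    .of_integral_ne_zero (by rw [hg_int]; exact one_ne_zero)
  have hWi : Integrable fun x => 1 / W x ^ (n + 1) :=
    .of_integral_ne_zero (by rw [hW_int]; exact one_ne_zero)
  have hgi' : Integrable fun x => 1 / g x ^ (n + 2) := by
    refine (hgi.const_mul (1 / b)).mono' (continuous_const.div (hgc.pow _)
      fun x => (pow_pos (hg_pos x) _).ne').aestronglyMeasurable (ae_of_all _ fun x => ?_)
    have hx := hg_pos x
    rw [Real.norm_of_nonneg (by positivity), one_div_mul_one_div]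
    refine one_div_le_one_div_of_le (by positivity) ?_
    rw [pow_succ' _ (n + 1)]
    exact mul_le_mul_of_nonneg_right (hgb x) (by positivity)
  set f : EuclideanSpace ℝ (Fin (n + 1)) → EReal := fun x =>
    legendreTransform W (∇ g x) / ((g x ^ (n + 1 + 1) : ℝ) : EReal) with hf
  have hfm : Measurable f := by
    have h1 : Measurable fun x => (((g x ^ (n + 1 + 1))⁻¹ : ℝ) : EReal) :=
      ((hgc.pow _).measurable.inv).coe_real_ereal
    exact ((measurable_legendreTransform W).comp hgradc.measurable).mul h1
  have hfle : ∀ x y, (((inner ℝ (∇ g x) y - W y) / g x ^ (n + 2) : ℝ) : EReal) ≤ f x := by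
    intro x y
    rw [EReal.coe_div]
    exact EReal.div_le_div_right_of_nonneg (by exact_mod_cast (pow_pos (hg_pos x) _).le)
      (le_legendreTransform W _ y)
  -- Taking `y = 0` in the supremum bounds the integrand below by `-W(0) / gⁿ⁺²`, which is
  -- integrable because `g` is bounded away from zero.
  have hneg : ∫⁻ x, (-f x).toENNReal ≠ ⊤ := by
    refine ne_top_of_le_ne_top (hgi'.const_mul (W 0)).lintegral_lt_top.ne
      (lintegral_mono fun x => ?_)
    have h := EReal.neg_le_neg_iff.2 (hfle x 0)
    rw [inner_zero_right, zero_sub, neg_div, EReal.coe_neg, neg_neg] at h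
    refine (EReal.toENNReal_le_toENNReal h).trans_eq ?_
    rw [EReal.toENNReal_of_ne_top (EReal.coe_ne_top _), EReal.toReal_coe, mul_one_div]
  have hinner : ∀ (x y : Fin (n + 1) → ℝ),
      inner ℝ (∇ g (WithLp.toLp 2 x)) (WithLp.toLp 2 y) = ∑ i, ∇ g (WithLp.toLp 2 x) i * y i :=
    fun x y => by
      rw [PiLp.inner_apply]
      exact Finset.sum_congr rfl fun i _ => mul_comm _ _
  have hLp : Continuous (WithLp.toLp 2 : (Fin (n + 1) → ℝ) → EuclideanSpace ℝ (Fin (n + 1))) :=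
    PiLp.continuous_toLp 2 _
  have hG' : Continuous fun (x : Fin (n + 1) → ℝ) i => ∇ g (WithLp.toLp 2 x) i :=
    (PiLp.continuous_ofLp 2 _).comp (hgradc.comp hLp)
  have hemb {u : EuclideanSpace ℝ (Fin (n + 1)) → ℝ} (hu : Integrable u) :
      Integrable fun x : Fin (n + 1) → ℝ => u (WithLp.toLp 2 x) :=
    (PiLp.volume_preserving_toLp (Fin (n + 1))).integrable_comp_of_integrable hu
  have hle : ∫⁻ x, (-f x).toENNReal ≤ ∫⁻ x, (f x).toENNReal := by
    rw [← lintegral_toLp, ← lintegral_toLp]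
    refine lintegral_neg_part_le_pos_part (G := fun x => g (WithLp.toLp 2 x))
      (W := fun x => W (WithLp.toLp 2 x)) (f := fun x => f (WithLp.toLp 2 x))
      (hgc.comp hLp) hG' (hasDerivAt_update_toLp hgd) (fun x => hg_pos _) (hWc.comp hLp) hc
      (fun x => hWb _) (hemb hgi) (hemb hgi') (hemb hWi) ?_ fun x y => ?_
    · rw [integral_toLp (fun x => 1 / g x ^ (n + 1)), integral_toLp (fun x => 1 / W x ^ (n + 1)),
        hg_int, hW_int]
    · rw [← hinner]
      exact hfle _ _
  refine ⟨⟨hfm.aemeasurable, hneg⟩, ?_, fun hgW hconv => ?_⟩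
  · rw [extendedIntegral, EReal.sub_nonneg]
    · exact EReal.coe_ennreal_le_coe_ennreal_iff.2 hle
    · exact Or.inr (by simpa using hneg)
    · exact Or.inr (EReal.coe_ennreal_ne_bot _)
  · have hge : ∫⁻ x, (f x).toENNReal ≤ ∫⁻ x, (-f x).toENNReal := by
      rw [← lintegral_toLp, ← lintegral_toLp]
      refine lintegral_pos_part_le_neg_part (G := fun x => g (WithLp.toLp 2 x))
        (f := fun x => f (WithLp.toLp 2 x))
        (hgc.comp hLp) hG' (hasDerivAt_update_toLp hgd) (fun x => hg_pos _) fun x => ?_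
      rw [← hinner, EReal.coe_div, ← legendreTransform_gradient hconv (hgd _)]
      simp only [hf, hgW]
    rw [extendedIntegral, le_antisymm hle hge]
    exact EReal.sub_self (by rw [← le_antisymm hle hge]; simpa using hneg)
      (EReal.coe_ennreal_ne_bot _)
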